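/- All graphs are finite, simple and connected. For a graph $G$ and an integer $l\ge 1$, an $l$-track on $G$ is a surjective map $f:\{1,\dots,l\}\to V(G)$ with $f(i)f(i+1)\in E(G)$ for all $1\le i<l$; an $l$-sweep is an $l$-track $f$ such that every edge $uv\in E(G)$ equals $f(i)f(i+1)$ (as an unordered pair) for some $1\le i<l$. For two maps $f,g:\{1,\dots,l\}\to V(G)$ put $m_G(f,g)=\min_{1\le i\le l} d_G(f(i),g(i))$. The direct vertex span $\sigma^{\times}_V(G)$ (resp. the direct edge span $\sigma^{\times}_E(G)$) is the maximum of $m_G(f,g)$ over all $l\ge 1$ and all pairs $f,g$ of $l$-tracks (resp. $l$-sweeps) on $G$. Let $K_4^+$ be the graph obtained from the complete graph $K_4$ by subdividing exactly one edge, i.e. replacing one edge $uv$ by a path $uwv$ through a new vertex $w$. Proposition. $K_4^+$ is the graph of minimal order and minimal size for which the direct vertex span differs from the direct edge span. That is: $K_4^+$ is a connected graph with $5$ vertices and $7$ edges and $\sigma^{\times}_V(K_4^+)\neq\sigma^{\times}_E(K_4^+)$; every finite connected graph $G$ with $\sigma^{\times}_V(G)\neq\sigma^{\times}_E(G)$ has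 at least $5$ vertices and at least $7$ edges; and every such $G$ with exactly $5$ vertices and exactly $7$ edges is isomorphic to $K_4^+$. -/

import Mathlib

namespace GraphSpan

variable {V : Type*}

/-- An `l`-track: a surjective sequence of `l` vertices in which any two consecutive terms
are adjacent. -/
def IsTrack (G : SimpleGraph V) {l : ℕ} (f : Fin l → V) : Prop :=
  Function.Surjective f ∧
    ∀ (i : ℕ) (h : i + 1 < l), G.Adj (f ⟨i, Nat.lt_of_succ_lt h⟩) (f ⟨i + 1, h⟩)

/-- An `l`-sweep: an `l`-track that traverses every edge, in one direction or the other. -/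
def IsSweep (G : SimpleGraph V) {l : ℕ} (f : Fin l → V) : Prop :=
  IsTrack G f ∧
    ∀ u v : V, G.Adj u v →
      ∃ (i : ℕ) (h : i + 1 < l), s(f ⟨i, Nat.lt_of_succ_lt h⟩, f ⟨i + 1, h⟩) = s(u, v)

/-- The distance `m(f, g)` between two sequences of `l` vertices: the least graph distance
between terms with the same index (for `l ≥ 1`). -/
noncomputable def seqDist (G : SimpleGraph V) {l : ℕ} (f g : Fin l → V) : ℕ :=
  ⨅ i : Fin l, G.dist (f i) (g i)

/-- The values `m(f, g)` for pairs of `l`-tracks `f`, `g`, with `l` arbitrary. -/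
def trackDistances (G : SimpleGraph V) : Set ℕ :=
  {m | ∃ (l : ℕ) (f g : Fin l → V), IsTrack G f ∧ IsTrack G g ∧ seqDist G f g = m}

/-- The values `m(f, g)` for pairs of `l`-sweeps `f`, `g`, with `l` arbitrary. -/
def sweepDistances (G : SimpleGraph V) : Set ℕ :=
  {m | ∃ (l : ℕ) (f g : Fin l → V), IsSweep G f ∧ IsSweep G g ∧ seqDist G f g = m}

/-- The direct vertex span: the largest `m(f, g)` over all `l` and all pairs of `l`-tracks.
For a finite connected graph the set is nonempty and bounded, so the supremum is a maximum. -/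
noncomputable def directVertexSpan (G : SimpleGraph V) : ℕ := sSup (trackDistances G)

/-- The direct edge span: the largest `m(f, g)` over all `l` and all pairs of `l`-sweeps.
For a finite connected graph the set is nonempty and bounded, so the supremum is a maximum. -/
noncomputable def directEdgeSpan (G : SimpleGraph V) : ℕ := sSup (sweepDistances G)

/-- Subdivision of the edge `uv`: the edge is replaced by the path `u w v` through a new vertex
`w = none`. -/
def edgeSubdivision (G : SimpleGraph V) (u v : V) : SimpleGraph (Option V) where
  Adj x y :=
    match x, y with
    | some a, some b => G.Adj a b ∧ s(a, b) ≠ s(u, v)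
    | some a, none => a = u ∨ a = v
    | none, some b => b = u ∨ b = v
    | none, none => False
  symm := by
    constructor
    rintro (_ | a) (_ | b) h
    · exact h
    · exact h
    · exact h
    · exact ⟨h.1.symm, by rw [Sym2.eq_swap]; exact h.2⟩
  loopless := by
    constructor
    rintro (_ | a) h
    · exact h
    · exact G.loopless.irrefl a h.1

/-- `K₄⁺`: the complete graph on four vertices with one edge subdivided. -/
def K4Plus : SimpleGraph (Option (Fin 4)) :=
  edgeSubdivision (⊤ : SimpleGraph (Fin 4)) 0 1

end GraphSpan

/-!
The two spans are compared through the graph of far pairs (`farGraph`): its vertices are the pairs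
of vertices of `G` and its edges the simultaneous moves that keep the distance at least `k`. A pair
of tracks with `m(f, g) ≥ k` is a walk in one component of this graph that projects onto all
vertices in both coordinates. If the edges of this component project onto all edges of `G` in both
coordinates, then one long closed walk in it gives two sweeps at distance at least `k`. So if the
spans differ, some component is an *obstruction* (`IsObstruction`, `exists_obstruction`): it
contains a pair `(u, y)` and is onto the vertices in both coordinates, while its first projection
never traverses an edge `uv`.

For an obstruction, the first projection shows that `G` minus `uv` is connected, so `G` is not a
tree and has at least as many edges as vertices (`IsObstruction.card_le`). Moreover `u`, `v`, `y`
are distinct and `y` is not adjacent to `u`. A graph with at most six edges and an obstruction thus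
has between three and six vertices; give `u`, `v`, `y` the labels `0`, `1`, `2`. The remaining
finitely many labelled graphs, and those with five vertices and seven edges, are checked by kernel
computation: the component of `(0, 2)` is saturated, and except for `K₄⁺` it either traverses the
edge `01` or misses a vertex in one coordinate. A graph with seven edges has at least five
vertices, which gives the bound on the order.

For `K₄⁺`, eight explicit moves give tracks at distance `2`. Sweeps at distance `2` do not exist:
while one player traverses the edge opposite to the subdivided one, the other would have to be at
the subdivision vertex at two consecutive times.
-/

namespace GraphSpan

variable {V : Type*}

/-! ### Pairs of vertices at distance at least `k` -/

/-- The graph on `V × V` whose edges are the simultaneous moves of two players that stay at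
distance at least `k`. Pairs at distance less than `k` are isolated vertices. A pair of sequences
`f`, `g` of consecutively adjacent vertices with `k ≤ m(f, g)` is a walk in this graph. -/
def farGraph (G : SimpleGraph V) (k : ℕ) : SimpleGraph (V × V) where
  Adj p q := k ≤ G.dist p.1 p.2 ∧ k ≤ G.dist q.1 q.2 ∧ G.Adj p.1 q.1 ∧ G.Adj p.2 q.2
  symm := ⟨fun _ _ h => ⟨h.2.1, h.1, h.2.2.1.symm, h.2.2.2.symm⟩⟩
  loopless := ⟨fun p h => G.loopless.irrefl p.1 h.2.2.1⟩

/-- An obstruction: a component of `farGraph G k`, containing `(u, y)`, that projects onto all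
vertices in both coordinates but whose first projection never traverses the edge `uv`. -/
structure IsObstruction (G : SimpleGraph V) (k : ℕ) (u v y : V) : Prop where
  adj : G.Adj u v
  far : k ≤ G.dist u y
  fst_onto : ∀ x, ∃ z, (farGraph G k).Reachable (u, y) (x, z)
  snd_onto : ∀ x, ∃ z, (farGraph G k).Reachable (u, y) (z, x)
  uncovered : ∀ z z', (farGraph G k).Reachable (u, y) (u, z) → ¬ (farGraph G k).Adj (u, z) (v, z')

theorem farGraph_reachable_swap {G : SimpleGraph V} {k : ℕ} {p q : V × V}
    (h : (farGraph G k).Reachable p q) : (farGraph G k).Reachable p.swap q.swap := by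
  let φ : farGraph G k →g farGraph G k :=
    { toFun := Prod.swap
      map_rel' := by
        intro a b h
        refine ⟨?_, ?_, h.2.2.2, h.2.2.1⟩
        · rw [SimpleGraph.dist_comm]; exact h.1
        · rw [SimpleGraph.dist_comm]; exact h.2.1 }
  exact h.map φ

theorem farGraph_reachable_of_tracks {G : SimpleGraph V} {k l : ℕ} {f g : Fin l → V}
    (hf : IsTrack G f) (hg : IsTrack G g) (hk : ∀ i, k ≤ G.dist (f i) (g i)) (i j : Fin l) :
    (farGraph G k).Reachable (f i, g i) (f j, g j) := by
  have key : ∀ (n : ℕ) (hn : n < l), (farGraph G k).Reachable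
      (f ⟨0, by omega⟩, g ⟨0, by omega⟩) (f ⟨n, hn⟩, g ⟨n, hn⟩) := by
    intro n
    induction n with
    | zero => intro hn; exact .refl _
    | succ n ih =>
      intro hn
      refine (ih (by omega)).trans (SimpleGraph.Adj.reachable ?_)
      exact ⟨hk _, hk _, hf.2 n hn, hg.2 n hn⟩
  exact (key i i.2).symm.trans (key j j.2)

/-- If there are no obstructions, the component of a pair of tracks traverses every edge in its
first coordinate. -/
theorem exists_adj_of_no_obstruction {G : SimpleGraph V} {k l : ℕ} {f g : Fin l → V}
    (hno : ∀ u v y, ¬ IsObstruction G k u v y)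
    (hf : IsTrack G f) (hg : IsTrack G g) (hk : ∀ i, k ≤ G.dist (f i) (g i)) (i : Fin l)
    {u v : V} (huv : G.Adj u v) :
    ∃ p q, (farGraph G k).Reachable (f i, g i) p ∧ (farGraph G k).Adj p q ∧ p.1 = u ∧ q.1 = v := by
  by_contra hcon
  obtain ⟨j, rfl⟩ := hf.1 u
  refine hno (f j) v (g j) ⟨huv, hk j, fun x => ?_, fun x => ?_, fun z z' h1 h2 => hcon ?_⟩
  · obtain ⟨m, rfl⟩ := hf.1 x
    exact ⟨_, farGraph_reachable_of_tracks hf hg hk j m⟩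
  · obtain ⟨m, rfl⟩ := hg.1 x
    exact ⟨_, farGraph_reachable_of_tracks hf hg hk j m⟩
  · exact ⟨_, _, (farGraph_reachable_of_tracks hf hg hk i j).trans h1, h2, rfl, rfl⟩

/-- Closed walks through a common vertex can be concatenated, so finitely many edges of one
component lie on a single closed walk. -/
theorem exists_closed_walk {W : Type*} (P : SimpleGraph W) (s : W) (D : Finset (W × W))
    (hD : ∀ d ∈ D, P.Reachable s d.1 ∧ P.Adj d.1 d.2) :
    ∃ w : P.Walk s s, ∀ d ∈ D, s(d.1, d.2) ∈ w.edges := by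
  classical
  induction D using Finset.induction_on with
  | empty => exact ⟨.nil, by simp⟩
  | insert d D _ ih =>
    obtain ⟨w, hw⟩ := ih fun d hd => hD d (Finset.mem_insert_of_mem hd)
    obtain ⟨⟨r⟩, had⟩ := hD d (Finset.mem_insert_self _ _)
    refine ⟨w.append (r.append (.cons had (.cons had.symm r.reverse))), ?_⟩
    intro d' hd'
    rcases Finset.mem_insert.1 hd' with rfl | hd'
    · simp
    · simp [hw d' hd']

/-- A walk in the graph of far pairs whose projection traverses every edge projects to a
sweep. -/
theorem isSweep_of_walk {G : SimpleGraph V} [Nontrivial V] (hG : G.Connected) {k : ℕ} {s t : V × V}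
    (w : (farGraph G k).Walk s t) (φ : V × V → V)
    (hφ : ∀ p q, (farGraph G k).Adj p q → G.Adj (φ p) (φ q))
    (hcov : ∀ u v, G.Adj u v → ∃ p q, s(p, q) ∈ w.edges ∧ φ p = u ∧ φ q = v) :
    IsSweep G (fun i : Fin (w.length + 1) => φ (w.getVert i)) := by
  have hedge : ∀ u v : V, G.Adj u v → ∃ (i : ℕ) (_ : i + 1 < w.length + 1),
      s(φ (w.getVert i), φ (w.getVert (i + 1))) = s(u, v) := by
    intro u v huv
    obtain ⟨p, q, hpq, rfl, rfl⟩ := hcov u v huv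
    obtain ⟨d, hd, hde⟩ := List.mem_map.1 hpq
    obtain ⟨i, hi, hi'⟩ := List.getElem_of_mem hd
    rw [SimpleGraph.Walk.length_darts] at hi
    refine ⟨i, by omega, ?_⟩
    have h1 : d.edge = s(w.getVert i, w.getVert (i + 1)) := by
      rw [← hi', SimpleGraph.Walk.darts_getElem_eq_getVert]; rfl
    rw [h1] at hde
    simpa using congrArg (Sym2.map φ) hde
  refine ⟨⟨fun u => ?_, fun i hi => hφ _ _ (w.adj_getVert_succ (Nat.lt_of_succ_lt_succ hi))⟩,
    fun u v huv => ?_⟩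
  · obtain ⟨v, huv⟩ := hG.preconnected.exists_adj_of_nontrivial u
    obtain ⟨i, hi, he⟩ := hedge u v huv
    have : u ∈ s(φ (w.getVert i), φ (w.getVert (i + 1))) := by rw [he]; exact Sym2.mem_mk_left _ _
    rcases Sym2.mem_iff.1 this with h | h
    · exact ⟨⟨i, by omega⟩, h.symm⟩
    · exact ⟨⟨i + 1, hi⟩, h.symm⟩
  · exact hedge u v huv

theorem seqDist_le (G : SimpleGraph V) {l : ℕ} (f g : Fin l → V) (i : Fin l) :
    seqDist G f g ≤ G.dist (f i) (g i) :=
  ciInf_le (OrderBot.bddBelow _) i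

/-- Two tracks at distance at least `k` yield two sweeps at distance at least `k`, unless there is
an obstruction. -/
theorem exists_sweeps_of_no_obstruction [Finite V] {G : SimpleGraph V} (hG : G.Connected)
    {k l : ℕ} (hk0 : 0 < k) {f g : Fin l → V} (hno : ∀ u v y, ¬ IsObstruction G k u v y)
    (hf : IsTrack G f) (hg : IsTrack G g) (hk : k ≤ seqDist G f g) :
    ∃ m ∈ sweepDistances G, k ≤ m := by
  classical
  have hk' : ∀ i, k ≤ G.dist (f i) (g i) := fun i => hk.trans (seqDist_le G f g i)
  obtain ⟨a⟩ := hG.nonempty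
  obtain ⟨i, -⟩ := hf.1 a
  have hne : f i ≠ g i := by
    intro h
    have := hk' i
    rw [h, SimpleGraph.dist_self] at this
    omega
  have : Nontrivial V := ⟨_, _, hne⟩
  let P := farGraph G k
  let s : V × V := (f i, g i)
  have := Fintype.ofFinite V
  let D : Finset ((V × V) × (V × V)) := Finset.univ.filter fun d => P.Reachable s d.1 ∧ P.Adj d.1 d.2
  obtain ⟨w, hw⟩ := exists_closed_walk P s D (by simp [D])
  have h1 := isSweep_of_walk hG w Prod.fst (fun p q h => h.2.2.1) (by
    intro u v huv
    obtain ⟨p, q, h1, h2, h3, h4⟩ := exists_adj_of_no_obstruction hno hf hg hk' i huv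
    exact ⟨p, q, hw (p, q) (by simp [D, P, s, h1, h2]), h3, h4⟩)
  have h2 := isSweep_of_walk hG w Prod.snd (fun p q h => h.2.2.2) (by
    intro u v huv
    obtain ⟨p, q, h1, h2, h3, h4⟩ := exists_adj_of_no_obstruction hno hg hf
      (fun i => by rw [SimpleGraph.dist_comm]; exact hk' i) i huv
    have h5 : P.Reachable s p.swap := farGraph_reachable_swap h1
    have h6 : P.Adj p.swap q.swap :=
      ⟨by rw [SimpleGraph.dist_comm]; exact h2.1, by rw [SimpleGraph.dist_comm]; exact h2.2.1,
        h2.2.2.2, h2.2.2.1⟩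
    exact ⟨p.swap, q.swap, hw (p.swap, q.swap) (Finset.mem_filter.2
      ⟨Finset.mem_univ _, h5, h6⟩), h3, h4⟩)
  refine ⟨_, ⟨_, _, _, h1, h2, rfl⟩, le_ciInf fun j => ?_⟩
  rcases Nat.lt_or_ge j w.length with hj | hj
  · exact (w.adj_getVert_succ hj).1
  · beta_reduce
    rw [w.getVert_of_length_le hj]
    exact hk' i

theorem bddAbove_trackDistances [Finite V] [Nonempty V] (G : SimpleGraph V) :
    BddAbove (trackDistances G) := by
  have hfin : (Set.range fun p : V × V => G.dist p.1 p.2).Finite := Set.finite_range _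
  obtain ⟨B, hB⟩ := hfin.bddAbove
  refine ⟨B, ?_⟩
  rintro m ⟨l, f, g, hf, -, rfl⟩
  obtain ⟨a⟩ := ‹Nonempty V›
  obtain ⟨i, -⟩ := hf.1 a
  exact (seqDist_le G f g i).trans (hB ⟨(f i, g i), rfl⟩)

theorem sweepDistances_subset (G : SimpleGraph V) : sweepDistances G ⊆ trackDistances G := by
  rintro m ⟨l, f, g, hf, hg, rfl⟩
  exact ⟨l, f, g, hf.1, hg.1, rfl⟩

/-- Different spans force an obstruction. -/
theorem exists_obstruction [Finite V] {G : SimpleGraph V} (hG : G.Connected)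
    (h : directVertexSpan G ≠ directEdgeSpan G) :
    ∃ k u v y, 0 < k ∧ IsObstruction G k u v y := by
  by_contra hcon
  push Not at hcon
  have := hG.nonempty
  have hb := bddAbove_trackDistances G
  have hb' := hb.mono (sweepDistances_subset G)
  have hle : directEdgeSpan G ≤ directVertexSpan G := by
    rcases (sweepDistances G).eq_empty_or_nonempty with h0 | h0
    · rw [directEdgeSpan, h0]; simp
    · exact csSup_le_csSup hb h0 (sweepDistances_subset G)
  have hlt : directEdgeSpan G < directVertexSpan G := lt_of_le_of_ne hle h.symm
  have hne : (trackDistances G).Nonempty := by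
    by_contra h0
    rw [Set.not_nonempty_iff_eq_empty] at h0
    rw [directVertexSpan, h0] at hlt
    simp at hlt
  obtain ⟨l, f, g, hf, hg, hm⟩ := Nat.sSup_mem hne hb
  have hk0 : 0 < directVertexSpan G := by omega
  obtain ⟨m, hm1, hm2⟩ := exists_sweeps_of_no_obstruction hG hk0 (hcon _ · · · hk0) hf hg hm.ge
  exact absurd (hm2.trans (le_csSup hb' hm1)) (by rw [← directEdgeSpan]; omega)

/-! ### Elementary constraints on an obstruction -/

section Obstruction

variable {G : SimpleGraph V} {k : ℕ} {u v y : V}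

/-- A pair `(u, v)` could swap along the edge `uv`. -/
theorem IsObstruction.ne_right (h : IsObstruction G k u v y) : v ≠ y := by
  rintro rfl
  exact h.uncovered v u (.refl _)
    ⟨h.far, by rw [SimpleGraph.dist_comm]; exact h.far, h.adj, h.adj.symm⟩

theorem IsObstruction.ne_left (h : IsObstruction G k u v y) (hk : 0 < k) : u ≠ y := by
  rintro rfl
  have := h.far
  rw [SimpleGraph.dist_self] at this
  omega

/-- If `u` and `y` were adjacent, then `k ≤ 1` and the pair `(u, y)` could move to `(v, u)`. -/
theorem IsObstruction.not_adj (h : IsObstruction G k u v y) : ¬ G.Adj u y := by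
  intro huy
  have hk := h.far
  rw [SimpleGraph.dist_eq_one_iff_adj.2 huy] at hk
  refine h.uncovered y u (.refl _) ⟨h.far, ?_, h.adj, huy.symm⟩
  rw [SimpleGraph.dist_comm, SimpleGraph.dist_eq_one_iff_adj.2 h.adj]
  exact hk

/-- The first projection of the component is connected and spanning and avoids `uv`, so the edge
`uv` is not a bridge. Hence `G` is not a tree. -/
theorem IsObstruction.card_le [Finite V] (h : IsObstruction G k u v y) :
    Nat.card V ≤ G.edgeSet.ncard := by
  have hstep : ∀ p, (farGraph G k).Reachable (u, y) p → (G.deleteEdges {s(u, v)}).Reachable u p.1 := by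
    rintro p hp
    rw [SimpleGraph.reachable_iff_reflTransGen] at hp
    induction hp with
    | refl => exact .refl _
    | @tail p q hp hpq ih =>
      rw [← SimpleGraph.reachable_iff_reflTransGen] at hp
      refine ih.trans (SimpleGraph.Adj.reachable ?_)
      rw [SimpleGraph.deleteEdges_adj]
      refine ⟨hpq.2.2.1, fun he => ?_⟩
      obtain ⟨a, b⟩ := p
      obtain ⟨c, d⟩ := q
      rcases Sym2.eq_iff.1 (Set.mem_singleton_iff.1 he) with ⟨h1, h2⟩ | ⟨h1, h2⟩
      · simp only at h1 h2
        subst h1 h2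
        exact h.uncovered _ _ hp hpq
      · simp only at h1 h2
        subst h1 h2
        exact h.uncovered _ _ (hp.trans hpq.reachable) hpq.symm
  have hconn : (G.deleteEdges {s(u, v)}).Connected := by
    have : Nonempty V := ⟨u⟩
    refine ⟨fun a b => ?_⟩
    obtain ⟨z, hz⟩ := h.fst_onto a
    obtain ⟨z', hz'⟩ := h.fst_onto b
    exact (hstep _ hz).symm.trans (hstep _ hz')
  have h1 := hconn.card_vert_le_card_edgeSet_add_one
  rw [SimpleGraph.edgeSet_deleteEdges, Nat.card_coe_set_eq] at h1
  have h2 := Set.ncard_sdiff_singleton_add_one (s := G.edgeSet) (a := s(u, v)) h.adj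
  omega

theorem dist_lt_card [Finite V] (hG : G.Connected) (a b : V) : G.dist a b < Nat.card V := by
  have := Fintype.ofFinite V
  obtain ⟨p, hp, hl⟩ := hG.exists_path_of_dist a b
  rw [← hl, Nat.card_eq_fintype_card]
  exact hp.length_lt

end Obstruction

/-! ### A search by bitmasks

Vertices are numbers below `8`. A set of vertices is the number whose bits are its members, and a
set of pairs, in particular the adjacency relation of a graph, is the number in which bit
`8 * a + b` stands for `(a, b)`. The definitions are written with the primitive operations on `ℕ`,
which the kernel evaluates on binary literals, and with recursors in place of compiled recursion.
-/

/-- The value `f x`. The case distinction makes the kernel evaluate `x` to a literal before it is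
substituted into `f`. -/
def force (x : ℕ) (f : ℕ → Bool) : Bool :=
  Nat.casesOn x (f 0) fun y => f y.succ

/-- Membership of `i` in the set `m`. -/
def bit (m i : ℕ) : Bool := ((m.shiftRight i).land 1).beq 1

/-- The union of the sets `f i` over the members `i < n` of `m`. -/
def orOver (f : ℕ → ℕ) (m n : ℕ) : ℕ :=
  Nat.rec 0 (fun i s => cond (bit m i) (Nat.lor s (f i)) s) n

def anyBelow (f : ℕ → Bool) (n : ℕ) : Bool :=
  Nat.rec false (fun i s => cond (f i) true s) n

/-- The section `{b | (a, b) ∈ m}` of a set of pairs. -/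
def row (m a : ℕ) : ℕ := Nat.land (Nat.shiftRight m (Nat.mul 8 a)) 255

/-- The vertices at distance at most `j` from `a`. -/
def ball (g n a j : ℕ) : ℕ :=
  Nat.rec (Nat.shiftLeft 1 a) (fun _ s => Nat.lor s (orOver (row g) s n)) j

/-- The pairs at distance more than `j` that are reached by a simultaneous move from the pair with
code `p`. -/
def moves (g n j p : ℕ) : ℕ :=
  orOver (fun a => Nat.shiftLeft (Nat.xor (row g (Nat.mod p 8))
    (Nat.land (row g (Nat.mod p 8)) (ball g n a j))) (Nat.mul 8 a)) (row g (Nat.div p 8)) n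

/-- Some pair `(0, b)` of `S` has a move to a pair `(1, b')`. -/
def covers (g n j S : ℕ) : Bool :=
  not ((row (orOver (moves g n j) S 8) 1).beq 0)

/-- One of the two projections of `S` misses a vertex. -/
def notOnto (n S : ℕ) : Bool :=
  anyBelow (fun a => or ((row S a).beq 0) (not (bit (orOver (row S) (2 ^ n - 1) n) a))) n

/-- Saturates `S` under moves, and tests whether the saturated set traverses the edge `01` or misses
a vertex. The result is `false` if `t` rounds do not suffice. -/
def explore (g n j t : ℕ) : ℕ → Bool :=
  Nat.rec (fun _ => false) (fun _ r S =>
    force (Nat.lor S (orOver (moves g n j) S (Nat.mul 8 n))) fun S' =>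
      cond (S'.beq S) (or (covers g n j S) (notOnto n S)) (r S')) t

/-- There is no obstruction at distance `j + 1` with `(u, v, y) = (0, 1, 2)` in `g`. The start `4` is
the set `{(0, 2)}`; testing it before it is saturated settles many graphs at once. -/
def noObstruction (g n j : ℕ) : Bool :=
  or (bit (ball g n 0 j) 2) (or (covers g n j 4) (explore g n j 12 4))

/-- The search finds no obstruction with `(u, v, y) = (0, 1, 2)` in the graph `g` on `n` vertices.
A graph with an isolated vertex is passed over, as it is not connected. Distances up to `5` suffice
for graphs on at most six vertices. -/
def clean (n g : ℕ) : Bool :=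
  or (anyBelow (fun a => (row g a).beq 0) n)
    (not (anyBelow (fun j => not (noObstruction g n j)) 5))

theorem bit_eq (m i : ℕ) : bit m i = m.testBit i := by
  have h : (m.shiftRight i).land 1 = 1 &&& (m >>> i) := Nat.land_comm _ _
  rw [bit, h, Nat.testBit]
  have : 1 &&& (m >>> i) < 2 := by
    rw [Nat.one_and_eq_mod_two]; omega
  interval_cases (1 &&& (m >>> i)) <;> rfl

theorem bit_lor (a b i : ℕ) : bit (Nat.lor a b) i = (bit a i || bit b i) := by
  simp only [bit_eq]; exact Nat.testBit_or a b i

theorem bit_land (a b i : ℕ) : bit (Nat.land a b) i = (bit a i && bit b i) := by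
  simp only [bit_eq]; exact Nat.testBit_and a b i

theorem bit_xor (a b i : ℕ) : bit (Nat.xor a b) i = (bit a i ^^ bit b i) := by
  simp only [bit_eq]; exact Nat.testBit_xor a b i

theorem bit_shiftLeft (m k i : ℕ) :
    bit (Nat.shiftLeft m k) i = (decide (k ≤ i) && bit m (i - k)) := by
  simp only [bit_eq]; exact Nat.testBit_shiftLeft m

theorem bit_shiftRight (m k i : ℕ) : bit (Nat.shiftRight m k) i = bit m (k + i) := by
  simp only [bit_eq]; exact Nat.testBit_shiftRight m

theorem bit_zero (i : ℕ) : bit 0 i = false := by simp [bit_eq]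

theorem bit_one (i : ℕ) : bit 1 i = true ↔ i = 0 := by
  rw [bit_eq, Nat.testBit_one_eq_true_iff_self_eq_zero]

theorem bit_two_pow_sub_one (n i : ℕ) : bit (2 ^ n - 1) i = true ↔ i < n := by
  rw [bit_eq, Nat.testBit_two_pow_sub_one, decide_eq_true_iff]

theorem exists_bit_of_ne_zero {m : ℕ} (h : m.beq 0 = false) : ∃ i, bit m i = true := by
  have h0 : m ≠ 0 := by
    rintro rfl
    simp at h
  obtain ⟨i, hi⟩ := Nat.exists_testBit_of_ne_zero h0
  exact ⟨i, by rw [bit_eq, hi]⟩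

theorem bit_orOver {f : ℕ → ℕ} {m n b : ℕ} :
    bit (orOver f m n) b = true ↔ ∃ i < n, bit m i = true ∧ bit (f i) b = true := by
  induction n with
  | zero => simp [orOver, bit_zero]
  | succ n ih =>
    have h : orOver f m (n + 1) = cond (bit m n) (Nat.lor (orOver f m n) (f n)) (orOver f m n) := rfl
    rw [h]
    simp only [Nat.lt_succ_iff_lt_or_eq, or_and_right, exists_or, exists_eq_left]
    cases hb : bit m n with
    | false => simp [ih]
    | true => rw [cond_true, bit_lor, Bool.or_eq_true, ih]; simp

theorem anyBelow_eq_true {f : ℕ → Bool} {n : ℕ} :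
    anyBelow f n = true ↔ ∃ i < n, f i = true := by
  induction n with
  | zero => simp [anyBelow]
  | succ n ih =>
    have h : anyBelow f (n + 1) = cond (f n) true (anyBelow f n) := rfl
    rw [h]
    simp only [Nat.lt_succ_iff_lt_or_eq, or_and_right, exists_or, exists_eq_left]
    cases hb : f n with
    | false => simp [ih]
    | true => simp

theorem bit_row {m a b : ℕ} : bit (row m a) b = true ↔ b < 8 ∧ bit m (8 * a + b) = true := by
  have h : bit 255 b = true ↔ b < 8 := bit_two_pow_sub_one 8 b
  rw [row, bit_land, bit_shiftRight, Bool.and_eq_true, h, and_comm]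
  rfl

theorem force_eq (x : ℕ) (f : ℕ → Bool) : force x f = f x := by cases x <;> rfl

/-! ### Correctness of the search -/

variable {n : ℕ} {G : SimpleGraph V} {x : Fin n ≃ V} {g : ℕ}

/-- The number `g` encodes the graph `G`, whose vertices are labelled by `x`: the pair `(a, b)` has
code `8 * a + b`. -/
def Encodes (G : SimpleGraph V) (x : Fin n ≃ V) (g : ℕ) : Prop :=
  ∀ a b, b < 8 → (bit g (8 * a + b) = true ↔
    ∃ (ha : a < n) (hb : b < n), G.Adj (x ⟨a, ha⟩) (x ⟨b, hb⟩))

theorem bit_row_graph (hn : n ≤ 8) (hg : Encodes G x g) {a b : ℕ} :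
    bit (row g a) b = true ↔ ∃ (ha : a < n) (hb : b < n), G.Adj (x ⟨a, ha⟩) (x ⟨b, hb⟩) := by
  rw [bit_row]
  constructor
  · rintro ⟨h1, h2⟩
    exact (hg a b h1).1 h2
  · rintro ⟨ha, hb, h⟩
    exact ⟨by omega, (hg a b (by omega)).2 ⟨ha, hb, h⟩⟩

theorem dist_le_succ_iff (hG : G.Connected) {a b : V} {j : ℕ} :
    G.dist a b ≤ j + 1 ↔ G.dist a b ≤ j ∨ ∃ c, G.dist a c ≤ j ∧ G.Adj c b := by
  constructor
  · intro h
    by_cases hab : a = b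
    · subst hab
      exact .inl (by simp)
    · obtain ⟨w, hw⟩ := hG.exists_walk_length_eq_dist b a
      cases w with
      | nil => exact absurd rfl hab
      | @cons _ c _ hadj w =>
        refine .inr ⟨c, ?_, hadj.symm⟩
        rw [SimpleGraph.Walk.length_cons, SimpleGraph.dist_comm] at hw
        have := SimpleGraph.dist_le w
        rw [SimpleGraph.dist_comm] at this
        omega
  · rintro (h | ⟨c, h1, h2⟩)
    · omega
    · have h3 := hG.dist_triangle (u := a) (v := c) (w := b)
      rw [SimpleGraph.dist_eq_one_iff_adj.2 h2] at h3
      omega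

theorem bit_ball (hn : n ≤ 8) (hG : G.Connected) (hg : Encodes G x g) {a b j : ℕ} (ha : a < n) :
    bit (ball g n a j) b = true ↔ ∃ hb : b < n, G.dist (x ⟨a, ha⟩) (x ⟨b, hb⟩) ≤ j := by
  induction j generalizing b with
  | zero =>
    have h : ball g n a 0 = Nat.shiftLeft 1 a := rfl
    rw [h, bit_shiftLeft, Bool.and_eq_true, bit_one, decide_eq_true_iff]
    simp only [Nat.le_zero, hG.dist_eq_zero_iff, x.injective.eq_iff, Fin.mk.injEq]
    constructor
    · rintro ⟨h1, h2⟩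
      exact ⟨by omega, by omega⟩
    · rintro ⟨h1, h2⟩
      omega
  | succ j ih =>
    have h : ball g n a (j + 1) = Nat.lor (ball g n a j) (orOver (row g) (ball g n a j) n) := rfl
    rw [h, bit_lor, Bool.or_eq_true, bit_orOver, ih]
    simp only [dist_le_succ_iff hG (j := j), ih, bit_row_graph hn hg]
    constructor
    · rintro (⟨h1, h2⟩ | ⟨c, h1, ⟨h2, h3⟩, h4, h5, h6⟩)
      · exact ⟨h1, .inl h2⟩
      · exact ⟨h5, .inr ⟨_, h3, h6⟩⟩
    · rintro ⟨h1, h2 | ⟨c, h2, h3⟩⟩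
      · exact .inl ⟨h1, h2⟩
      · obtain ⟨c, rfl⟩ := x.surjective c
        exact .inr ⟨c, c.2, ⟨c.2, h2⟩, c.2, h1, h3⟩

theorem bit_moves (hn : n ≤ 8) (hG : G.Connected) (hg : Encodes G x g) {j : ℕ} {a b : Fin n}
    {c d : ℕ} (hd : d < 8) (hab : j + 1 ≤ G.dist (x a) (x b)) :
    bit (moves g n j (8 * a + b)) (8 * c + d) = true ↔
      ∃ (hc : c < n) (hd : d < n),
        (farGraph G (j + 1)).Adj (x a, x b) (x ⟨c, hc⟩, x ⟨d, hd⟩) := by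
  have hb : (b : ℕ) < 8 := by omega
  have h1 : Nat.mod (8 * a + b) 8 = b := by
    change (8 * (a : ℕ) + b) % 8 = b
    omega
  have h2 : Nat.div (8 * a + b) 8 = a := by
    change (8 * (a : ℕ) + b) / 8 = a
    omega
  rw [moves, bit_orOver, h1, h2]
  constructor
  · rintro ⟨i, hi, hai, hbit⟩
    rw [bit_shiftLeft, bit_xor, bit_land, Bool.and_eq_true, decide_eq_true_iff] at hbit
    obtain ⟨hle, hbit⟩ := hbit
    change 8 * i ≤ 8 * c + d at hle
    change (bit (row g b) (8 * c + d - 8 * i) ^^ (bit (row g b) (8 * c + d - 8 * i) &&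
      bit (ball g n i j) (8 * c + d - 8 * i))) = true at hbit
    have h3 : bit (row g b) (8 * c + d - 8 * i) = true := by
      by_contra h
      rw [Bool.not_eq_true] at h
      simp [h] at hbit
    have h4 : ¬ bit (ball g n i j) (8 * c + d - 8 * i) = true := by
      intro h
      simp [h, h3] at hbit
    obtain ⟨-, hlt, -⟩ := (bit_row_graph hn hg).1 h3
    have hci : c = i := by omega
    subst hci
    have he : 8 * c + d - 8 * c = d := by omega
    rw [he] at h3 h4
    obtain ⟨_, hlt, hadj⟩ := (bit_row_graph hn hg).1 h3
    rw [bit_ball hn hG hg hi] at h4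
    obtain ⟨_, _, hadj'⟩ := (bit_row_graph hn hg).1 hai
    refine ⟨hi, hlt, hab, ?_, hadj', hadj⟩
    by_contra hcon
    exact h4 ⟨hlt, by simpa [Nat.lt_succ_iff] using hcon⟩
  · rintro ⟨hc, hd', -, hfar, hac, hbd⟩
    refine ⟨c, hc, (bit_row_graph hn hg).2 ⟨a.2, hc, hac⟩, ?_⟩
    have he : 8 * c + d - Nat.mul 8 c = d := by
      change 8 * c + d - 8 * c = d
      omega
    have hle : Nat.mul 8 c ≤ 8 * c + d := by
      change 8 * c ≤ 8 * c + d
      omega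
    have h3 : bit (row g b) d = true := (bit_row_graph hn hg).2 ⟨b.2, hd', hbd⟩
    have h4 : bit (ball g n c j) d = false := by
      rw [← Bool.not_eq_true, bit_ball hn hG hg hc]
      rintro ⟨_, h⟩
      simp only at hfar
      omega
    rw [bit_shiftLeft, bit_xor, bit_land, he, h3, h4, decide_eq_true hle]
    rfl

section Component

variable {j : ℕ} {s : V × V}

/-- All members of `S` are pairs in the component of `s`. -/
def Within (G : SimpleGraph V) (x : Fin n ≃ V) (j : ℕ) (s : V × V) (S : ℕ) : Prop :=
  ∀ a b, b < 8 → bit S (8 * a + b) = true → ∃ (ha : a < n) (hb : b < n),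
    (farGraph G (j + 1)).Reachable s (x ⟨a, ha⟩, x ⟨b, hb⟩)

theorem far_of_reachable {k : ℕ} {p : V × V} (hs : k ≤ G.dist s.1 s.2)
    (h : (farGraph G k).Reachable s p) : k ≤ G.dist p.1 p.2 := by
  rw [SimpleGraph.reachable_iff_reflTransGen] at h
  cases h with
  | refl => exact hs
  | tail _ h => exact h.2.1

theorem Within.step (hn : n ≤ 8) (hG : G.Connected) (hg : Encodes G x g)
    (hs : j + 1 ≤ G.dist s.1 s.2) {S N c d : ℕ} (hS : Within G x j s S) (hd : d < 8)
    (h : bit (orOver (moves g n j) S N) (8 * c + d) = true) :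
    ∃ (a b : Fin n) (hc : c < n) (hd : d < n), 8 * (a : ℕ) + b < N ∧
      (farGraph G (j + 1)).Reachable s (x a, x b) ∧
      (farGraph G (j + 1)).Adj (x a, x b) (x ⟨c, hc⟩, x ⟨d, hd⟩) := by
  obtain ⟨p, hpN, hp, hm⟩ := bit_orOver.1 h
  have hpe : 8 * (p / 8) + p % 8 = p := by omega
  rw [← hpe] at hp
  obtain ⟨ha, hb, hr⟩ := hS _ _ (by omega) hp
  rw [← hpe] at hm
  obtain ⟨hc, hd, hadj⟩ :=
    (bit_moves hn hG hg (a := ⟨_, ha⟩) (b := ⟨_, hb⟩) hd (far_of_reachable hs hr)).1 hm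
  exact ⟨⟨_, ha⟩, ⟨_, hb⟩, hc, hd, by simp only; omega, hr, hadj⟩

theorem Within.lor (hn : n ≤ 8) (hG : G.Connected) (hg : Encodes G x g)
    (hs : j + 1 ≤ G.dist s.1 s.2) {S N : ℕ} (hS : Within G x j s S) :
    Within G x j s (Nat.lor S (orOver (moves g n j) S N)) := by
  intro a b hb h
  rw [bit_lor, Bool.or_eq_true] at h
  rcases h with h | h
  · exact hS a b hb h
  · obtain ⟨_, _, ha, hb, -, hr, hadj⟩ := hS.step hn hG hg hs hb h
    exact ⟨ha, hb, hr.trans hadj.reachable⟩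

/-- A set that is closed under moves and contains `s` contains the component of `s`. -/
theorem bit_of_reachable (hn : n ≤ 8) (hG : G.Connected) (hg : Encodes G x g)
    {S : ℕ} (hS : Nat.lor S (orOver (moves g n j) S (Nat.mul 8 n)) = S)
    (hsS : bit S (8 * (x.symm s.1 : ℕ) + (x.symm s.2 : ℕ)) = true) {p : V × V}
    (h : (farGraph G (j + 1)).Reachable s p) :
    bit S (8 * (x.symm p.1 : ℕ) + (x.symm p.2 : ℕ)) = true := by
  rw [SimpleGraph.reachable_iff_reflTransGen] at h
  induction h with
  | refl => exact hsS
  | @tail p q hp hpq ih =>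
    rw [← SimpleGraph.reachable_iff_reflTransGen] at hp
    rw [← hS, bit_lor, Bool.or_eq_true]
    right
    refine bit_orOver.2 ⟨_, ?_, ih, ?_⟩
    · change _ < 8 * n
      have := (x.symm p.1).2
      have := (x.symm p.2).2
      omega
    · refine (bit_moves hn hG hg (by omega) ?_).2 ⟨Fin.is_lt _, Fin.is_lt _, ?_⟩
      · simpa using hpq.1
      · simpa using hpq

end Component

section Obstruction

variable {j : ℕ} {h0 : 0 < n} {h1 : 1 < n} {h2 : 2 < n}

theorem IsObstruction.not_covers
    (h : IsObstruction G (j + 1) (x ⟨0, h0⟩) (x ⟨1, h1⟩) (x ⟨2, h2⟩)) (hn : n ≤ 8)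
    (hG : G.Connected) (hg : Encodes G x g) {S : ℕ}
    (hS : Within G x j (x ⟨0, h0⟩, x ⟨2, h2⟩) S) : covers g n j S = false := by
  rw [covers, Bool.not_eq_false', ← Bool.not_eq_false]
  intro hc
  obtain ⟨b, hb⟩ := exists_bit_of_ne_zero hc
  rw [bit_row] at hb
  obtain ⟨c, d, _, _, hlt, hr, hadj⟩ := hS.step hn hG hg h.far hb.1 hb.2
  have hc0 : c = ⟨0, h0⟩ := Fin.ext (by simp only; omega)
  subst hc0
  exact h.uncovered _ _ hr hadj

theorem IsObstruction.not_notOnto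
    (h : IsObstruction G (j + 1) (x ⟨0, h0⟩) (x ⟨1, h1⟩) (x ⟨2, h2⟩)) (hn : n ≤ 8) {S : ℕ}
    (hS : ∀ p, (farGraph G (j + 1)).Reachable (x ⟨0, h0⟩, x ⟨2, h2⟩) p →
      bit S (8 * (x.symm p.1 : ℕ) + (x.symm p.2 : ℕ)) = true) : notOnto n S = false := by
  rw [← Bool.not_eq_true, notOnto, anyBelow_eq_true]
  rintro ⟨a, ha, hc⟩
  rw [Bool.or_eq_true] at hc
  rcases hc with hc | hc
  · obtain ⟨z, hz⟩ := h.fst_onto (x ⟨a, ha⟩)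
    have hb := hS _ hz
    simp only [Equiv.symm_apply_apply] at hb
    have hb' : bit (row S a) (x.symm z) = true := bit_row.2 ⟨by omega, hb⟩
    rw [Nat.eq_of_beq_eq_true hc, bit_zero] at hb'
    exact absurd hb' (by decide)
  · obtain ⟨z, hz⟩ := h.snd_onto (x ⟨a, ha⟩)
    have hb := hS _ hz
    simp only [Equiv.symm_apply_apply] at hb
    have : bit (orOver (row S) (2 ^ n - 1) n) a = true :=
      bit_orOver.2 ⟨x.symm z, Fin.is_lt _, (bit_two_pow_sub_one _ _).2 (Fin.is_lt _),
        bit_row.2 ⟨by omega, hb⟩⟩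
    rw [this] at hc
    exact absurd hc (by decide)

theorem IsObstruction.not_explore
    (h : IsObstruction G (j + 1) (x ⟨0, h0⟩) (x ⟨1, h1⟩) (x ⟨2, h2⟩)) (hn : n ≤ 8)
    (hG : G.Connected) (hg : Encodes G x g) {t : ℕ} {S : ℕ}
    (hS : Within G x j (x ⟨0, h0⟩, x ⟨2, h2⟩) S) (hs : bit S 2 = true) :
    explore g n j t S = false := by
  induction t generalizing S with
  | zero => rfl
  | succ t ih =>
    have he : explore g n j (t + 1) S =
      force (Nat.lor S (orOver (moves g n j) S (Nat.mul 8 n))) fun S' =>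
        cond (S'.beq S) (or (covers g n j S) (notOnto n S)) (explore g n j t S') := rfl
    rw [he, force_eq]
    cases hb : (Nat.lor S (orOver (moves g n j) S (Nat.mul 8 n))).beq S with
    | false =>
      exact ih (hS.lor hn hG hg h.far) (by rw [bit_lor, hs]; rfl)
    | true =>
      have hno := h.not_notOnto hn fun p hp =>
        bit_of_reachable hn hG hg (Nat.eq_of_beq_eq_true hb) (by simpa using hs) hp
      simp only [cond_true]
      rw [h.not_covers hn hG hg hS, hno]
      rfl

theorem IsObstruction.not_clean
    (h : IsObstruction G (j + 1) (x ⟨0, h0⟩) (x ⟨1, h1⟩) (x ⟨2, h2⟩)) (hn : n ≤ 8) (hj : j < 5)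
    (hG : G.Connected) (hg : Encodes G x g) : clean n g = false := by
  have hW : Within G x j (x ⟨0, h0⟩, x ⟨2, h2⟩) 4 := by
    intro a b hb hbit
    have h4 : bit 4 (8 * a + b) = true ↔ 8 * a + b = 2 := by
      have : (4 : ℕ) = Nat.shiftLeft 1 2 := rfl
      rw [this, bit_shiftLeft, Bool.and_eq_true, bit_one, decide_eq_true_iff]
      omega
    rw [h4] at hbit
    obtain ⟨rfl, rfl⟩ : a = 0 ∧ b = 2 := by omega
    exact ⟨h0, h2, .refl _⟩
  have hball : bit (ball g n 0 j) 2 = false := by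
    rw [← Bool.not_eq_true, bit_ball hn hG hg h0]
    rintro ⟨_, hle⟩
    have := h.far
    omega
  have hno : noObstruction g n j = false := by
    rw [noObstruction, hball, h.not_covers hn hG hg hW, h.not_explore hn hG hg hW rfl]
    rfl
  have hany : anyBelow (fun j => not (noObstruction g n j)) 5 = true :=
    anyBelow_eq_true.2 ⟨j, hj, by rw [hno]; rfl⟩
  rw [clean, hany, Bool.not_true, Bool.or_false, ← Bool.not_eq_true, anyBelow_eq_true]
  rintro ⟨a, ha, hz⟩
  have : Nontrivial V := ⟨_, _, h.adj.ne⟩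
  obtain ⟨b, hb⟩ := hG.preconnected.exists_adj_of_nontrivial (x ⟨a, ha⟩)
  obtain ⟨b, rfl⟩ := x.surjective b
  have hbit := (bit_row_graph hn hg).2 ⟨ha, b.2, hb⟩
  rw [Nat.eq_of_beq_eq_true hz, bit_zero] at hbit
  exact absurd hbit (by decide)

end Obstruction

/-! ### The graph `K₄⁺` -/

theorem K4Plus_adj_none_some {a : Fin 4} : K4Plus.Adj none (some a) ↔ a = 0 ∨ a = 1 := Iff.rfl

theorem K4Plus_adj_some_some {a b : Fin 4} :
    K4Plus.Adj (some a) (some b) ↔ a ≠ b ∧ s(a, b) ≠ s(0, 1) := Iff.rfl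

instance : DecidableRel K4Plus.Adj
  | none, none => isFalse id
  | none, some a => decidable_of_iff _ (K4Plus_adj_none_some (a := a)).symm
  | some a, none => decidable_of_iff _ ((K4Plus_adj_none_some (a := a)).symm.trans
      (K4Plus.adj_comm _ _))
  | some a, some b => decidable_of_iff _ (K4Plus_adj_some_some (a := a) (b := b)).symm

theorem K4Plus_connected : K4Plus.Connected := by
  have h : ∀ x, K4Plus.Reachable (some 2) x := by
    have h0 : K4Plus.Adj (some 2) (some 0) := by decide
    have h1 : K4Plus.Adj (some 2) (some 1) := by decide
    have h3 : K4Plus.Adj (some 2) (some 3) := by decide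
    have hn : K4Plus.Adj (some 0) none := by decide
    rintro (_ | x)
    · exact h0.reachable.trans hn.reachable
    · fin_cases x
      exacts [h0.reachable, h1.reachable, .refl _, h3.reachable]
  exact ⟨fun a b => (h a).symm.trans (h b)⟩

theorem K4Plus_ncard_edgeSet : K4Plus.edgeSet.ncard = 7 := by
  rw [Set.ncard_eq_toFinset_card']
  decide +kernel

theorem K4Plus_two_le_dist_iff {x y : Option (Fin 4)} :
    2 ≤ K4Plus.dist x y ↔ x ≠ y ∧ ¬ K4Plus.Adj x y := by
  constructor
  · rintro h
    refine ⟨?_, fun hadj => ?_⟩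
    · rintro rfl
      rw [SimpleGraph.dist_self] at h
      omega
    · rw [SimpleGraph.dist_eq_one_iff_adj.2 hadj] at h
      omega
  · rintro ⟨h1, h2⟩
    exact K4Plus_connected.one_lt_dist_of_ne_of_not_adj h1 h2

/-- The subdivision vertex is far from the ends of the opposite edge, and the ends of the subdivided
edge are far from each other; the two tracks alternate between these pairs. -/
theorem two_le_directVertexSpan_K4Plus (hb : BddAbove (trackDistances K4Plus)) :
    2 ≤ directVertexSpan K4Plus := by
  let f : Fin 8 → Option (Fin 4) := ![some 0, none, some 1, some 2, some 0, some 3, some 0, none]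
  let g : Fin 8 → Option (Fin 4) := ![some 1, some 2, some 0, none, some 1, none, some 1, some 3]
  have hf : IsTrack K4Plus f := by
    refine ⟨by unfold Function.Surjective; decide, fun i hi => ?_⟩
    have : ∀ i : Fin 7, K4Plus.Adj (f i.castSucc) (f i.succ) := by decide
    exact this ⟨i, by omega⟩
  have hg : IsTrack K4Plus g := by
    refine ⟨by unfold Function.Surjective; decide, fun i hi => ?_⟩
    have : ∀ i : Fin 7, K4Plus.Adj (g i.castSucc) (g i.succ) := by decide
    exact this ⟨i, by omega⟩
  have hfg : ∀ i, f i ≠ g i ∧ ¬ K4Plus.Adj (f i) (g i) := by decide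
  have h2 : 2 ≤ seqDist K4Plus f g := le_ciInf fun i => K4Plus_two_le_dist_iff.2 (hfg i)
  exact h2.trans (le_csSup hb ⟨8, f, g, hf, hg, rfl⟩)

/-- While one player traverses the edge opposite to the subdivided one, the only vertex far from
both of its ends is the subdivision vertex, and the other player cannot stay there. -/
theorem directEdgeSpan_K4Plus_le_one : directEdgeSpan K4Plus ≤ 1 := by
  rcases (sweepDistances K4Plus).eq_empty_or_nonempty with h0 | h0
  · rw [directEdgeSpan, h0]; simp
  refine csSup_le h0 ?_
  rintro m ⟨l, f, g, hf, hg, rfl⟩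
  by_contra hlt
  obtain ⟨i, hi, he⟩ := hf.2 (some 2) (some 3) (by decide)
  have hfar : ∀ j, f j ≠ g j ∧ ¬ K4Plus.Adj (f j) (g j) := fun j =>
    K4Plus_two_le_dist_iff.1 ((by omega : 2 ≤ seqDist K4Plus f g).trans
      (ciInf_le (OrderBot.bddBelow _) j))
  have h1 := hfar ⟨i, by omega⟩
  have h2 := hfar ⟨i + 1, hi⟩
  have h3 := hg.1.2 i hi
  have key : ∀ a b : Option (Fin 4), K4Plus.Adj a b →
      ¬ ((some 2 ≠ a ∧ ¬ K4Plus.Adj (some 2) a) ∧ (some 3 ≠ b ∧ ¬ K4Plus.Adj (some 3) b)) := by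
    decide
  rcases Sym2.eq_iff.1 he with ⟨e1, e2⟩ | ⟨e1, e2⟩
  · rw [e1] at h1
    rw [e2] at h2
    exact key _ _ h3 ⟨h1, h2⟩
  · rw [e1] at h1
    rw [e2] at h2
    exact key _ _ h3.symm ⟨h2, h1⟩

/-! ### Enumeration of the graphs -/

/-- The code of the graph whose only edge is `e`. -/
def edgeMask (e : ℕ × ℕ) : ℕ :=
  Nat.lor (Nat.shiftLeft 1 (8 * e.1 + e.2)) (Nat.shiftLeft 1 (8 * e.2 + e.1))

/-- The test `C` succeeds for all graphs obtained from `g` by adding at most `b` edges from `l`. -/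
def forallSub (C : ℕ → Bool) : List (ℕ × ℕ) → ℕ → ℕ → Bool
  | [], _, g => C g
  | _ :: _, 0, g => C g
  | e :: l, b + 1, g =>
    and (forallSub C l (b + 1) g) (force (Nat.lor g (edgeMask e)) (forallSub C l b))

/-- The pairs `i < j < n` other than `(0, 1)` and `(0, 2)`. -/
def slots (n : ℕ) : List (ℕ × ℕ) :=
  (List.range n).flatMap fun j => ((List.range j).map fun i => (i, j)).filter
    fun e => ¬ (e.1 = 0 ∧ (e.2 = 1 ∨ e.2 = 2))

/-- The code of `K₄⁺` in the labelling where `2` is the subdivision vertex, with neighbours `3`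
and `4`. -/
def k4PlusCode : ℕ :=
  [(0, 1), (0, 3), (0, 4), (1, 3), (1, 4), (2, 3), (2, 4)].foldl
    (fun g e => Nat.lor g (edgeMask e)) 0

theorem forallSub_clean_three : forallSub (clean 3) (slots 3) 5 (edgeMask (0, 1)) = true := by
  decide +kernel

theorem forallSub_clean_four : forallSub (clean 4) (slots 4) 5 (edgeMask (0, 1)) = true := by
  decide +kernel

/-- With five vertices and at most six edges besides `01`, the only graph that may have an obstruction
is `K₄⁺`. -/
theorem forallSub_clean_five :
    forallSub (fun g => or (g.beq k4PlusCode) (clean 5 g)) (slots 5) 6 (edgeMask (0, 1)) = true := by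
  decide +kernel

theorem forallSub_clean_six : forallSub (clean 6) (slots 6) 5 (edgeMask (0, 1)) = true := by
  decide +kernel

/-- Adds to `g` the edges of `l` selected by `sel`. -/
def addEdges (sel : ℕ × ℕ → Bool) : List (ℕ × ℕ) → ℕ → ℕ
  | [], g => g
  | e :: l, g => addEdges sel l (cond (sel e) (Nat.lor g (edgeMask e)) g)

theorem addEdges_of_countP_eq_zero {sel : ℕ × ℕ → Bool} {l : List (ℕ × ℕ)} {g : ℕ}
    (h : l.countP sel = 0) : addEdges sel l g = g := by
  induction l generalizing g with
  | nil => rfl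
  | cons e l ih =>
    rw [List.countP_eq_zero] at h
    have he : sel e = false := by simpa using h e (by simp)
    rw [addEdges, he]
    exact ih (List.countP_eq_zero.2 fun a ha => h a (by simp [ha]))

theorem apply_addEdges_of_forallSub {C : ℕ → Bool} {sel : ℕ × ℕ → Bool} {l : List (ℕ × ℕ)}
    {b g : ℕ} (h : forallSub C l b g = true) (hb : l.countP sel ≤ b) :
    C (addEdges sel l g) = true := by
  induction l generalizing b g with
  | nil => cases b <;> exact h
  | cons e l ih =>
    cases b with
    | zero => rwa [addEdges_of_countP_eq_zero (by omega)]
    | succ b =>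
      rw [forallSub, Bool.and_eq_true, force_eq] at h
      rw [addEdges]
      cases hs : sel e with
      | false =>
        rw [List.countP_cons_of_neg (by simp [hs])] at hb
        exact ih h.1 hb
      | true =>
        rw [List.countP_cons_of_pos hs] at hb
        exact ih h.2 (by omega)

theorem bit_addEdges {sel : ℕ × ℕ → Bool} {l : List (ℕ × ℕ)} {g i : ℕ} :
    bit (addEdges sel l g) i = true ↔
      bit g i = true ∨ ∃ e ∈ l, sel e = true ∧ bit (edgeMask e) i = true := by
  induction l generalizing g with
  | nil => simp [addEdges]
  | cons e l ih =>
    rw [addEdges, ih]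
    cases hs : sel e with
    | false => simp [hs]
    | true => simp only [cond_true, bit_lor, Bool.or_eq_true, List.mem_cons, exists_eq_or_imp, hs,
        true_and, or_assoc]

theorem bit_edgeMask {e : ℕ × ℕ} {c d : ℕ} (h1 : e.1 < 8) (h2 : e.2 < 8) (hd : d < 8) :
    bit (edgeMask e) (8 * c + d) = true ↔ (c = e.1 ∧ d = e.2) ∨ (c = e.2 ∧ d = e.1) := by
  rw [edgeMask, bit_lor, bit_shiftLeft, bit_shiftLeft]
  simp only [Bool.or_eq_true, Bool.and_eq_true, bit_one, decide_eq_true_iff]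
  omega

theorem mem_slots {n : ℕ} {e : ℕ × ℕ} :
    e ∈ slots n ↔ e.1 < e.2 ∧ e.2 < n ∧ ¬ (e.1 = 0 ∧ (e.2 = 1 ∨ e.2 = 2)) := by
  obtain ⟨i, j⟩ := e
  simp only [slots, List.mem_flatMap, List.mem_range, List.mem_filter, List.mem_map,
    decide_eq_true_iff, Prod.mk.injEq]
  grind

/-- Selects the pairs that are edges of `G` in the labelling `x`. -/
noncomputable def isEdge (G : SimpleGraph V) (x : Fin n ≃ V) (e : ℕ × ℕ) : Bool :=
  open scoped Classical in
  decide (∃ (h1 : e.1 < n) (h2 : e.2 < n), G.Adj (x ⟨e.1, h1⟩) (x ⟨e.2, h2⟩))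

theorem isEdge_eq_true {x : Fin n ≃ V} {e : ℕ × ℕ} : isEdge G x e = true ↔
    ∃ (h1 : e.1 < n) (h2 : e.2 < n), G.Adj (x ⟨e.1, h1⟩) (x ⟨e.2, h2⟩) := by
  classical
  rw [isEdge, decide_eq_true_iff]

theorem encodes_addEdges (hn : n ≤ 8) {x : Fin n ≃ V} {h0 : 0 < n} {h1 : 1 < n} {h2 : 2 < n}
    (h01 : G.Adj (x ⟨0, h0⟩) (x ⟨1, h1⟩)) (h02 : ¬ G.Adj (x ⟨0, h0⟩) (x ⟨2, h2⟩)) :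
    Encodes G x (addEdges (isEdge G x) (slots n) (edgeMask (0, 1))) := by
  intro a b hb
  rw [bit_addEdges, bit_edgeMask (by simp) (by simp) hb]
  constructor
  · rintro ((⟨rfl, rfl⟩ | ⟨rfl, rfl⟩) | ⟨e, he, hs, hbit⟩)
    · exact ⟨h0, h1, h01⟩
    · exact ⟨h1, h0, h01.symm⟩
    · obtain ⟨he1, he2, hadj⟩ := isEdge_eq_true.1 hs
      rw [bit_edgeMask (by omega) (by omega) hb] at hbit
      rcases hbit with ⟨rfl, rfl⟩ | ⟨rfl, rfl⟩
      · exact ⟨he1, he2, hadj⟩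
      · exact ⟨he2, he1, hadj.symm⟩
  · rintro ⟨ha, hb', hadj⟩
    -- It suffices to treat an edge whose ends have increasing labels.
    have key : ∀ i k (hi : i < n) (hk : k < n), i < k → G.Adj (x ⟨i, hi⟩) (x ⟨k, hk⟩) →
        (i = 0 ∧ k = 1) ∨ ((i, k) ∈ slots n ∧ isEdge G x (i, k) = true) := by
      intro i k hi hk hik hadj
      by_cases h : i = 0 ∧ k = 1
      · exact .inl h
      · refine .inr ⟨mem_slots.2 ⟨hik, hk, ?_⟩, isEdge_eq_true.2 ⟨hi, hk, hadj⟩⟩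
        rintro ⟨rfl, rfl | rfl⟩
        · exact h ⟨rfl, rfl⟩
        · exact h02 hadj
    rcases lt_trichotomy a b with hab | rfl | hab
    · rcases key a b ha hb' hab hadj with h | ⟨h, h'⟩
      · exact .inl (.inl h)
      · exact .inr ⟨_, h, h', (bit_edgeMask (by simp only; omega) hb hb).2 (.inl ⟨rfl, rfl⟩)⟩
    · exact absurd hadj (G.loopless.irrefl _)
    · rcases key b a hb' ha hab hadj.symm with h | ⟨h, h'⟩
      · exact .inl (.inr h.symm)
      · exact .inr ⟨_, h, h',
          (bit_edgeMask hb (by simp only; omega) hb).2 (.inr ⟨rfl, rfl⟩)⟩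

/-- The selected pairs are distinct edges of `G`, and the edge `01` is not among them. -/
theorem countP_isEdge_lt [Finite V] {x : Fin n ≃ V} {h0 : 0 < n} {h1 : 1 < n}
    (h01 : G.Adj (x ⟨0, h0⟩) (x ⟨1, h1⟩)) (hnd : (slots n).Nodup) :
    (slots n).countP (isEdge G x) < G.edgeSet.ncard := by
  classical
  have := Fintype.ofFinite V
  rw [List.countP_eq_length_filter,
    ← List.toFinset_card_of_nodup (hnd.filter _), Set.ncard_eq_toFinset_card']
  let ψ : ℕ × ℕ → Sym2 V := fun e =>
    s(if h : e.1 < n then x ⟨e.1, h⟩ else x ⟨0, h0⟩, if h : e.2 < n then x ⟨e.2, h⟩ else x ⟨0, h0⟩)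
  have hmem : ∀ e ∈ ((slots n).filter (isEdge G x)).toFinset, ∃ (h1 : e.1 < n) (h2 : e.2 < n),
      ψ e = s(x ⟨e.1, h1⟩, x ⟨e.2, h2⟩) ∧ G.Adj (x ⟨e.1, h1⟩) (x ⟨e.2, h2⟩) ∧ e.1 < e.2 ∧
        ¬ (e.1 = 0 ∧ (e.2 = 1 ∨ e.2 = 2)) := by
    intro e he
    rw [List.mem_toFinset, List.mem_filter, mem_slots, isEdge_eq_true] at he
    obtain ⟨⟨h3, h4, h5⟩, h6, h7, h8⟩ := he
    exact ⟨h6, h7, by simp only [ψ, h6, h7, dite_true], h8, h3, h5⟩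
  refine lt_of_le_of_lt (b := (G.edgeSet.toFinset.erase s(x ⟨0, h0⟩, x ⟨1, h1⟩)).card) ?_
    (Finset.card_erase_lt_of_mem (by simpa using h01))
  refine Finset.card_le_card_of_injOn ψ ?_ ?_
  · intro e he
    obtain ⟨h3, h4, h5, h6, h7, h8⟩ := hmem e he
    rw [h5]
    simp only [Finset.coe_erase, Set.coe_toFinset, Set.mem_sdiff, SimpleGraph.mem_edgeSet, h6,
      Set.mem_singleton_iff, true_and, Sym2.eq_iff, x.injective.eq_iff, Fin.mk.injEq]
    omega
  · intro e he e' he' heq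
    obtain ⟨h3, h4, h5, h6, h7, h8⟩ := hmem e he
    obtain ⟨h3', h4', h5', h6', h7', h8'⟩ := hmem e' he'
    rw [h5, h5'] at heq
    simp only [Sym2.eq_iff, x.injective.eq_iff, Fin.mk.injEq] at heq
    ext <;> omega

/-- Three distinct vertices can be labelled `0`, `1`, `2`. -/
theorem exists_labelling [Finite V] (hn : Nat.card V = n) {u v y : V} (huv : u ≠ v) (huy : u ≠ y)
    (hvy : v ≠ y) : ∃ (x : Fin n ≃ V) (h0 : 0 < n) (h1 : 1 < n) (h2 : 2 < n),
      x ⟨0, h0⟩ = u ∧ x ⟨1, h1⟩ = v ∧ x ⟨2, h2⟩ = y := by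
  classical
  have := Fintype.ofFinite V
  have hlt : 2 < n := by
    rw [← hn, Nat.card_eq_fintype_card]
    exact Fintype.two_lt_card_iff.2 ⟨u, v, y, huv, huy, hvy⟩
  let x₀ : Fin n ≃ V := (Finite.equivFinOfCardEq hn).symm
  let x₁ := x₀.trans (Equiv.swap (x₀ ⟨0, by omega⟩) u)
  let x₂ := x₁.trans (Equiv.swap (x₁ ⟨1, by omega⟩) v)
  let x₃ := x₂.trans (Equiv.swap (x₂ ⟨2, by omega⟩) y)
  have e1 : x₁ ⟨0, by omega⟩ = u := by simp [x₁]
  have e2 : x₂ ⟨1, by omega⟩ = v := by simp [x₂]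
  have e3 : x₃ ⟨2, by omega⟩ = y := by simp [x₃]
  have f1 : x₂ ⟨0, by omega⟩ = u := by
    have : u ≠ x₁ ⟨1, by omega⟩ := by
      rw [← e1]; exact x₁.injective.ne (by simp)
    simp only [x₂, Equiv.trans_apply, e1]
    exact Equiv.swap_apply_of_ne_of_ne this huv
  have g1 : x₃ ⟨0, by omega⟩ = u := by
    have : u ≠ x₂ ⟨2, by omega⟩ := by
      rw [← f1]; exact x₂.injective.ne (by simp)
    simp only [x₃, Equiv.trans_apply, f1]
    exact Equiv.swap_apply_of_ne_of_ne this huy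
  have g2 : x₃ ⟨1, by omega⟩ = v := by
    have : v ≠ x₂ ⟨2, by omega⟩ := by
      rw [← e2]; exact x₂.injective.ne (by simp)
    simp only [x₃, Equiv.trans_apply, e2]
    exact Equiv.swap_apply_of_ne_of_ne this hvy
  exact ⟨x₃, by omega, by omega, hlt, g1, g2, e3⟩

/-- A graph on at most six vertices with an obstruction has an encoding, met in the enumeration,
that fails the test. -/
theorem IsObstruction.exists_encoding [Finite V] (hG : G.Connected) (hn : Nat.card V = n)
    (hn6 : n ≤ 6) {k : ℕ} {u v y : V} (hk : 0 < k) (h : IsObstruction G k u v y)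
    (hnd : (slots n).Nodup) : ∃ (x : Fin n ≃ V) (sel : ℕ × ℕ → Bool),
      Encodes G x (addEdges sel (slots n) (edgeMask (0, 1))) ∧
      clean n (addEdges sel (slots n) (edgeMask (0, 1))) = false ∧
      (slots n).countP sel < G.edgeSet.ncard := by
  obtain ⟨x, h0, h1, h2, rfl, rfl, rfl⟩ :=
    exists_labelling hn h.adj.ne (h.ne_left hk) h.ne_right
  obtain ⟨j, rfl⟩ : ∃ j, k = j + 1 := ⟨k - 1, by omega⟩
  have hg := encodes_addEdges (by omega) h.adj h.not_adj
  -- A distance `k = j + 1` that occurs is less than the number of vertices.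
  have hj : j < 5 := by
    have h3 := h.far
    have h4 := dist_lt_card hG (x ⟨0, h0⟩) (x ⟨2, h2⟩)
    omega
  exact ⟨x, isEdge G x, hg, h.not_clean (by omega) hj hG hg, countP_isEdge_lt h.adj hnd⟩

theorem five_le_card_of_seven_le_ncard_edgeSet [Finite V] (G : SimpleGraph V)
    (h : 7 ≤ G.edgeSet.ncard) : 5 ≤ Nat.card V := by
  classical
  have := Fintype.ofFinite V
  by_contra hlt
  have h1 := G.card_edgeFinset_le_card_choose_two
  rw [Set.ncard_eq_toFinset_card'] at h
  have h2 := Nat.choose_le_choose 2 (by rw [← Nat.card_eq_fintype_card]; omega : Fintype.card V ≤ 4)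
  have h3 : Nat.choose 4 2 = 6 := rfl
  have h4 : G.edgeFinset.card = G.edgeSet.toFinset.card := rfl
  omega

/-- The labelling of `K₄⁺` encoded by `k4PlusCode`. -/
def k4PlusLabelling : Fin 5 ≃ Option (Fin 4) where
  toFun := ![some 2, some 3, none, some 0, some 1]
  invFun
    | none => 2
    | some a => ![3, 4, 0, 1] a
  left_inv := by unfold Function.LeftInverse; decide
  right_inv := by unfold Function.RightInverse Function.LeftInverse; decide

theorem nonempty_iso_of_encodes {x : Fin 5 ≃ V} (h : Encodes G x k4PlusCode) :
    Nonempty (G ≃g K4Plus) := by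
  have key : ∀ a b : Fin 5, bit k4PlusCode (8 * (a : ℕ) + b) = true ↔
      K4Plus.Adj (k4PlusLabelling a) (k4PlusLabelling b) := by
    decide
  refine ⟨⟨x.symm.trans k4PlusLabelling, ?_⟩⟩
  intro p q
  obtain ⟨a, rfl⟩ := x.surjective p
  obtain ⟨b, rfl⟩ := x.surjective q
  simp only [Equiv.trans_apply, Equiv.symm_apply_apply]
  rw [← key, h a b (by omega)]
  exact ⟨fun ⟨_, _, hadj⟩ => hadj, fun hadj => ⟨a.2, b.2, hadj⟩⟩

theorem IsObstruction.nonempty_iso [Finite V] (hG : G.Connected) {k : ℕ} {u v y : V}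
    (hk : 0 < k) (h : IsObstruction G k u v y) (hn : Nat.card V = 5)
    (hm : G.edgeSet.ncard ≤ 7) : Nonempty (G ≃g K4Plus) := by
  obtain ⟨x, sel, hg, hc, hcount⟩ := h.exists_encoding hG hn (by omega) hk (by decide)
  have hor := apply_addEdges_of_forallSub forallSub_clean_five (sel := sel) (by omega)
  rw [hc, Bool.or_false] at hor
  rw [Nat.eq_of_beq_eq_true hor] at hg
  exact nonempty_iso_of_encodes hg

theorem IsObstruction.seven_le_ncard_edgeSet [Finite V] (hG : G.Connected) {k : ℕ} {u v y : V}
    (hk : 0 < k) (h : IsObstruction G k u v y) : 7 ≤ G.edgeSet.ncard := by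
  by_contra hlt
  have hle := h.card_le
  obtain ⟨x, h0, h1, h2, -⟩ := exists_labelling rfl h.adj.ne (h.ne_left hk) h.ne_right
  obtain ⟨n, hn⟩ : ∃ n, Nat.card V = n := ⟨_, rfl⟩
  have h3 : 3 ≤ n := by omega
  have h6 : n ≤ 6 := by omega
  clear x h0 h1 h2
  interval_cases n
  · obtain ⟨x, sel, -, hc, hcount⟩ := h.exists_encoding hG hn h6 hk (by decide)
    rw [apply_addEdges_of_forallSub forallSub_clean_three (by omega)] at hc
    exact absurd hc (by decide)
  · obtain ⟨x, sel, -, hc, hcount⟩ := h.exists_encoding hG hn h6 hk (by decide)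
    rw [apply_addEdges_of_forallSub forallSub_clean_four (by omega)] at hc
    exact absurd hc (by decide)
  · obtain ⟨e⟩ := h.nonempty_iso hG hk hn (by omega)
    have := Nat.card_congr e.mapEdgeSet
    rw [Nat.card_coe_set_eq, Nat.card_coe_set_eq, K4Plus_ncard_edgeSet] at this
    omega
  · obtain ⟨x, sel, -, hc, hcount⟩ := h.exists_encoding hG hn h6 hk (by decide)
    rw [apply_addEdges_of_forallSub forallSub_clean_six (by omega)] at hc
    exact absurd hc (by decide)

end GraphSpan

theorem mainTheorem2 :
    GraphSpan.K4Plus.Connected ∧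
    Nat.card (Option (Fin 4)) = 5 ∧
    GraphSpan.K4Plus.edgeSet.ncard = 7 ∧
    GraphSpan.directVertexSpan GraphSpan.K4Plus ≠ GraphSpan.directEdgeSpan GraphSpan.K4Plus ∧
    ∀ {V : Type*} [Finite V] (G : SimpleGraph V), G.Connected →
      GraphSpan.directVertexSpan G ≠ GraphSpan.directEdgeSpan G →
        5 ≤ Nat.card V ∧ 7 ≤ G.edgeSet.ncard ∧
        (Nat.card V = 5 → G.edgeSet.ncard = 7 → Nonempty (G ≃g GraphSpan.K4Plus)) := by
  open GraphSpan in
  have hb := bddAbove_trackDistances K4Plus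
  refine ⟨K4Plus_connected, by simp, K4Plus_ncard_edgeSet, ?_, ?_⟩
  · have h1 := two_le_directVertexSpan_K4Plus hb
    have h2 := directEdgeSpan_K4Plus_le_one
    omega
  · intro V _ G hG hne
    obtain ⟨k, u, v, y, hk, h⟩ := exists_obstruction hG hne
    have h7 := h.seven_le_ncard_edgeSet hG hk
    exact ⟨five_le_card_of_seven_le_ncard_edgeSet G h7, h7,
      fun hn hm => h.nonempty_iso hG hk hn hm.le⟩
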